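/- For an integer $d\ge 1$, let $\tau(d)$ denote the largest $t$ for which there is a sequence of vectors $v_1,\dots,v_t\in[-1,1]^d$ such that $v_1+\cdots+v_t\in[-1,1]^d$ but $\sum_{i\in S}v_i\notin[-1,1]^d$ for every $S\subset\{1,\dots,t\}$ with $2\le|S|<t$ (with $\tau(d)=\infty$ if there were such sequences of arbitrarily large length). Then there is a constant $c>0$ such that $$\tau(d)\ \ge\ (cd)^{d/2}$$ for all $d$ that are powers of $2$. -/

import Mathlib

/-- The box `[-1,1]^d` in `ℝ^d` (the order on `Fin d → ℝ` is coordinatewise). -/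
def box (d : ℕ) : Set (Fin d → ℝ) := Set.Icc (-1) 1

/-- `v₁, …, v_t` is a minimal sequence of vectors in the box with sum in the box: every `vᵢ` lies
in the box, the total sum lies in the box, and for every set `S` of indices with `2 ≤ |S| < t`
the sum over `S` lies outside the box. -/
def IsMinimalBoxSeq {d t : ℕ} (v : Fin t → Fin d → ℝ) : Prop :=
  (∀ i, v i ∈ box d) ∧
  (∑ i, v i) ∈ box d ∧
  ∀ S : Finset (Fin t), 2 ≤ S.card → S.card < t → (∑ i ∈ S, v i) ∉ box d

/-- `tau d` is the largest length `t` of a minimal sequence in `[-1,1]^d` with sum in the box.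
It is taken as a supremum in `ℕ ∪ {∞}`, so that there is no default value: it would be `∞`
if there were arbitrarily long minimal sequences, and otherwise it is the maximum. -/
noncomputable def tau (d : ℕ) : ℕ∞ :=
  sSup {n : ℕ∞ | ∃ (t : ℕ) (v : Fin t → Fin d → ℝ), IsMinimalBoxSeq v ∧ n = (t : ℕ∞)}

/-! An invertible sign matrix `A` with a large solution of `A z = w`, where `w` is a sign vector,
yields a long minimal sequence. Flipping rows and columns makes `w = 1` and `z ≥ 0`. If `q` is the
least common denominator of `z`, then `q * z j` copies of column `j` together with `q` copies of the
all `-1` vector sum to zero. Invertibility and the minimality of `q` prevent a proper nonempty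
subfamily from doing so. Raising each entry `-1` to `-1 + 1/t` pushes the other subsums out of the
box (`sum_le_tau_of_relation`), hence `‖z‖₁ ≤ τ` (`sum_abs_le_tau`).

A suitable `A` of order `d = 2 ^ m` is indexed by the subsets of an `m`-set. In terms of the Walsh
transform `y` of `z`, its system is triangular for the colex order, and `y` grows by a factor of at
least `2 ^ (#i - 3)` from each large set to its successor `i` (`recursion_growth`). Since set sizes
average `m / 2`, the last value is `2 ^ (d * m / 2 - O(d))`, and it is at most `‖z‖₁`. -/

open Finset Colex in
/-- `p` is the colex-predecessor of `i` among the sets with at least five elements. -/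
def IsPred {α : Type*} [LinearOrder α] (i p : Finset α) : Prop :=
  5 ≤ #i ∧ 5 ≤ #p ∧ toColex p < toColex i ∧
    ∀ j : Finset α, 5 ≤ #j → toColex j < toColex i → toColex j ≤ toColex p

/-- The Walsh character `x ↦ (-1) ^ |a ∩ x|`. -/
def walsh {α : Type*} [DecidableEq α] (a x : Finset α) : ℤ := ∏ b ∈ a, if b ∈ x then -1 else 1

/-! ### Ill-conditioned sign matrices from Walsh characters. -/

section Rows

open Finset Colex

variable {α : Type*}

/-- If `i \ p` had two elements, adding the smaller one to `p` would give a set strictly between `p`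
and `i`. -/
lemma IsPred.card_inter [LinearOrder α] {i p : Finset α} (h : IsPred i p) :
    #(i ∩ p) + 1 = #i := by
  obtain ⟨-, hp, hlt, hmax⟩ := h
  obtain ⟨a, hai, hap, ha⟩ := toColex_lt_toColex_iff_exists_forall_lt.1 hlt
  have key : ∀ c ∈ i, c ∉ p → ∀ e ∈ i, e ∉ p → ¬ e < c := by
    intro c hci hcp e hei hep hec
    -- the larger one of `a`, `c` witnesses `insert e p < i`
    have hq : toColex p < toColex (insert e p) :=
      toColex_lt_toColex_of_ssubset (ssubset_insert hep)
    refine absurd (hmax (insert e p) (hp.trans (card_le_card (subset_insert _ _))) ?_)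
      (not_le.2 hq)
    rw [toColex_lt_toColex_iff_exists_forall_lt]
    rcases le_total a c with hac | hca
    · refine ⟨c, hci, by simp [hcp, hec.ne'], fun b hb hbi => ?_⟩
      rcases mem_insert.1 hb with rfl | hb
      · exact absurd hei hbi
      · exact (ha b hb hbi).trans_le hac
    · refine ⟨a, hai, by simp [hap, (hec.trans_le hca).ne'], fun b hb hbi => ?_⟩
      rcases mem_insert.1 hb with rfl | hb
      · exact absurd hei hbi
      · exact ha b hb hbi
  have h1 : i \ p = {a} := by
    refine eq_singleton_iff_unique_mem.2 ⟨by simp [hai, hap], fun c hc => ?_⟩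
    rw [mem_sdiff] at hc
    exact le_antisymm (not_lt.1 (key c hc.1 hc.2 a hai hap)) (not_lt.1 (key a hai hap c hc.1 hc.2))
  rw [← card_inter_add_card_sdiff i p, h1, card_singleton]

lemma exists_isPred [LinearOrder α] [Fintype α] {i j : Finset α} (hj : 5 ≤ #j) (hi : 5 ≤ #i)
    (hji : toColex j < toColex i) : ∃ p, IsPred i p := by
  obtain ⟨p, hp, hmax⟩ := exists_max_image
    (univ.filter fun j : Finset α => 5 ≤ #j ∧ toColex j < toColex i) toColex
    ⟨j, by simp [hj, hji]⟩
  simp only [mem_filter, mem_univ, true_and, and_imp] at hp hmax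
  exact ⟨p, hi, hp.1, hp.2, hmax⟩

lemma IsPred.unique [LinearOrder α] {i p q : Finset α} (hp : IsPred i p) (hq : IsPred i q) :
    p = q :=
  toColex.injective (le_antisymm (hq.2.2.2 p hp.2.1 hp.2.2.1) (hp.2.2.2 q hq.2.1 hq.2.2.1))

/-- This and the next two lemmas place the lower-order terms of the recursion: they precede `i` and
differ from `p`. -/
lemma IsPred.union_left_lt [LinearOrder α] {i p a : Finset α} (ha : a ⊂ i ∩ p) :
    toColex (a ∪ (i \ p)) < toColex i := by
  apply toColex_lt_toColex_of_ssubset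
  obtain ⟨h1, b, hb, hba⟩ := ssubset_iff_exists_cons_subset.1 ha |>.elim
    fun b ⟨h, h'⟩ => (⟨ha.1, b, h' (mem_cons_self _ _), h⟩ : a ⊆ i ∩ p ∧ ∃ b ∈ i ∩ p, b ∉ a)
  rw [mem_inter] at hb
  refine ⟨union_subset (h1.trans inter_subset_left) sdiff_subset, fun h => ?_⟩
  have := h hb.1
  simp [hba, hb.2] at this

lemma IsPred.union_left_ne [LinearOrder α] {i p a : Finset α} (h : IsPred i p) :
    a ∪ (i \ p) ≠ p := by
  intro he
  obtain ⟨c, hci, hcp, -⟩ := toColex_lt_toColex_iff_exists_forall_lt.1 h.2.2.1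
  apply hcp
  rw [← he]
  simp [hci, hcp]

lemma IsPred.union_right_lt [LinearOrder α] {i p a : Finset α} (ha : a ⊂ i ∩ p) :
    toColex (a ∪ (p \ i)) < toColex p :=
  IsPred.union_left_lt (by rwa [inter_comm])

lemma walsh_eq [DecidableEq α] (a x : Finset α) : walsh a x = 1 ∨ walsh a x = -1 := by
  unfold walsh
  induction a using Finset.induction_on with
  | empty => simp
  | insert b a hb ih =>
    rw [prod_insert hb]
    rcases ih with h | h <;> rw [h] <;> split_ifs <;> simp

lemma walsh_union [DecidableEq α] {a b : Finset α} (h : Disjoint a b) (x : Finset α) :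
    walsh (a ∪ b) x = walsh a x * walsh b x := prod_union h

lemma sum_powerset_walsh [DecidableEq α] (s x : Finset α) :
    ∑ a ∈ s.powerset, walsh a x = if Disjoint s x then 2 ^ #s else 0 := by
  unfold walsh
  rw [← prod_one_add]
  split_ifs with h
  · rw [prod_congr rfl (g := fun _ => (2 : ℤ)), prod_const]
    intro b hb
    rw [if_neg (disjoint_left.1 h hb)]; norm_num
  · rw [not_disjoint_iff] at h
    obtain ⟨b, hb, hbx⟩ := h
    exact prod_eq_zero hb (by simp [hbx])

/-- The sum of `walsh a x` over `a ⊆ i ∩ p` is `2 ^ #(i ∩ p)` or `0`, so the right side is `2 ^ #(i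
∩ p)` times either `0` or `2 * walsh p x`. Thus `r x` is `± walsh p x`. -/
lemma exists_sign_row [DecidableEq α] (i p : Finset α) : ∃ r : Finset α → ℤ,
    (∀ x, r x = 1 ∨ r x = -1) ∧ ∀ x, 2 ^ #(i ∩ p) * (r x + walsh p x) =
      ∑ a ∈ (i ∩ p).powerset, (walsh (a ∪ (i \ p)) x + walsh (a ∪ (p \ i)) x) := by
  refine ⟨fun x => if Disjoint (i ∩ p) x ∧ walsh (i \ p) x = walsh (p \ i) x then walsh p x
    else - walsh p x, fun x => ?_, fun x => ?_⟩
  · rcases walsh_eq p x with h | h <;> simp only [h] <;> split_ifs <;> simp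
  · have hd : ∀ a ∈ (i ∩ p).powerset, walsh (a ∪ (i \ p)) x + walsh (a ∪ (p \ i)) x
        = walsh a x * (walsh (i \ p) x + walsh (p \ i) x) := by
      intro a ha
      rw [mem_powerset] at ha
      rw [walsh_union, walsh_union, mul_add]
      · exact disjoint_of_subset_left (ha.trans inter_subset_left) disjoint_sdiff
      · exact disjoint_of_subset_left (ha.trans inter_subset_right) disjoint_sdiff
    rw [sum_congr rfl hd, ← sum_mul, sum_powerset_walsh]
    by_cases h1 : Disjoint (i ∩ p) x
    · have hp : walsh p x = walsh (p \ i) x := by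
        conv_lhs => rw [← sdiff_union_inter p i, walsh_union (disjoint_sdiff_inter p i)]
        have : walsh (p ∩ i) x = 1 := by
          rw [inter_comm]
          exact prod_eq_one fun b hb => if_neg (disjoint_left.1 h1 hb)
        rw [this, mul_one]
      rcases walsh_eq (i \ p) x with h2 | h2 <;> rcases walsh_eq (p \ i) x with h3 | h3 <;>
        simp [h1, hp, h2, h3]
    · simp [h1]

lemma exists_sign_matrix (α : Type*) [LinearOrder α] :
    ∃ A : Matrix (Finset α) (Finset α) ℤ,
      (∀ i x, A i x = 1 ∨ A i x = -1) ∧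
      (∀ i p, IsPred i p → ∀ x, 2 ^ #(i ∩ p) * (A i x + walsh p x) =
        ∑ a ∈ (i ∩ p).powerset, (walsh (a ∪ (i \ p)) x + walsh (a ∪ (p \ i)) x)) ∧
      ∀ i, (¬ ∃ p, IsPred i p) → A i = walsh i := by
  have : ∀ i : Finset α, ∃ r : Finset α → ℤ, (∀ x, r x = 1 ∨ r x = -1) ∧
      (∀ p, IsPred i p → ∀ x, 2 ^ #(i ∩ p) * (r x + walsh p x) =
        ∑ a ∈ (i ∩ p).powerset, (walsh (a ∪ (i \ p)) x + walsh (a ∪ (p \ i)) x)) ∧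
      ((¬ ∃ p, IsPred i p) → r = walsh i) := by
    intro i
    by_cases h : ∃ p, IsPred i p
    · obtain ⟨p, hp⟩ := h
      obtain ⟨r, h1, h2⟩ := exists_sign_row i p
      exact ⟨r, h1, fun q hq => hp.unique hq ▸ h2, fun h => absurd ⟨p, hp⟩ h⟩
    · exact ⟨walsh i, walsh_eq i, fun p hp => absurd ⟨p, hp⟩ h, fun _ => rfl⟩
  choose A h1 h2 h3 using this
  exact ⟨A, h1, h2, h3⟩

/-- The Walsh transform. -/
noncomputable def walshTransform [DecidableEq α] [Fintype α] (z : Finset α → ℝ)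
    (a : Finset α) : ℝ := ∑ x, (walsh a x : ℝ) * z x

lemma sum_walsh_mul_walsh [DecidableEq α] [Fintype α] (x y : Finset α) :
    ∑ a, walsh a x * walsh a y = if x = y then 2 ^ Fintype.card α else 0 := by
  unfold walsh
  simp_rw [← prod_mul_distrib]
  rw [← powerset_univ, ← prod_one_add]
  split_ifs with h
  · subst h
    rw [prod_congr rfl (g := fun _ => (2 : ℤ)), prod_const, card_univ]
    intro b _
    split_ifs <;> norm_num
  · obtain ⟨b, hb⟩ : ∃ b, ¬ (b ∈ x ↔ b ∈ y) := by
      by_contra! hc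
      exact h (ext hc)
    refine prod_eq_zero (mem_univ b) ?_
    by_cases h1 : b ∈ x <;> by_cases h2 : b ∈ y <;> simp_all

lemma eq_zero_of_walshTransform [DecidableEq α] [Fintype α] {z : Finset α → ℝ}
    (h : ∀ a, walshTransform z a = 0) : z = 0 := by
  funext y
  have h1 : ∑ a, (walsh a y : ℝ) * walshTransform z a = 2 ^ Fintype.card α * z y := by
    unfold walshTransform
    simp_rw [mul_sum]
    rw [sum_comm]
    have : ∀ x, ∑ a, (walsh a y : ℝ) * (walsh a x * z x)
        = (if y = x then 2 ^ Fintype.card α else 0) * z x := by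
      intro x
      have := congrArg (Int.cast : ℤ → ℝ) (sum_walsh_mul_walsh y x)
      push_cast at this
      rw [← this, sum_mul]
      exact sum_congr rfl fun a _ => by ring
    simp_rw [this]
    simp
  simp only [h, mul_zero, sum_const_zero] at h1
  simpa using h1.symm

lemma abs_walshTransform_le [DecidableEq α] [Fintype α] (z : Finset α → ℝ) (a : Finset α) :
    |walshTransform z a| ≤ ∑ x, |z x| := by
  refine (abs_sum_le_sum_abs _ _).trans (sum_le_sum fun x _ => ?_)
  rcases walsh_eq a x with h | h <;> simp [h]

lemma sum_powerset_eq_ssubsets {M : Type*} [AddCommMonoid M] [DecidableEq α] (s : Finset α)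
    (f : Finset α → M) : ∑ a ∈ s.powerset, f a = f s + ∑ a ∈ s.ssubsets, f a := by
  rw [ssubsets, add_sum_erase _ _ (mem_powerset_self s)]

/-- The linear system of a matrix as in `exists_sign_matrix`, in terms of the Walsh transform. -/
lemma walshTransform_recursion [LinearOrder α] [Fintype α]
    {A : Matrix (Finset α) (Finset α) ℤ} {i p : Finset α}
    (hA : ∀ x, 2 ^ #(i ∩ p) * (A i x + walsh p x) =
        ∑ a ∈ (i ∩ p).powerset, (walsh (a ∪ (i \ p)) x + walsh (a ∪ (p \ i)) x))
    (z : Finset α → ℝ) :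
    2 ^ #(i ∩ p) * (∑ x, (A i x : ℝ) * z x + walshTransform z p) =
      walshTransform z i + walshTransform z p + ∑ a ∈ (i ∩ p).ssubsets,
        (walshTransform z (a ∪ (i \ p)) + walshTransform z (a ∪ (p \ i))) := by
  have h1 : ∑ a ∈ (i ∩ p).powerset,
      (walshTransform z (a ∪ (i \ p)) + walshTransform z (a ∪ (p \ i))) =
      2 ^ #(i ∩ p) * (∑ x, (A i x : ℝ) * z x + walshTransform z p) := by
    unfold walshTransform
    simp_rw [← sum_add_distrib, ← add_mul]
    rw [sum_comm, mul_sum]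
    refine sum_congr rfl fun x _ => ?_
    have := congrArg (Int.cast : ℤ → ℝ) (hA x)
    push_cast at this
    rw [← mul_assoc, this, sum_mul]
  have h2 : i ∩ p ∪ i \ p = i := by rw [union_comm, sdiff_union_inter]
  have h3 : i ∩ p ∪ p \ i = p := by rw [union_comm, inter_comm, sdiff_union_inter]
  rw [← h1, sum_powerset_eq_ssubsets, h2, h3]

/-- The recursion determines the transform at `i` from strictly smaller sets, so it vanishes by
colex induction. -/
lemma sign_matrix_injective [LinearOrder α] [Fintype α]
    {A : Matrix (Finset α) (Finset α) ℤ}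
    (hA : ∀ i p, IsPred i p → ∀ x, 2 ^ #(i ∩ p) * (A i x + walsh p x) =
        ∑ a ∈ (i ∩ p).powerset, (walsh (a ∪ (i \ p)) x + walsh (a ∪ (p \ i)) x))
    (hA' : ∀ i, (¬ ∃ p, IsPred i p) → A i = walsh i)
    {z : Finset α → ℝ} (hz : ∀ i, ∑ x, (A i x : ℝ) * z x = 0) : z = 0 := by
  refine eq_zero_of_walshTransform fun i => ?_
  suffices h : ∀ u : Colex (Finset α), walshTransform z (ofColex u) = 0 from h (toColex i)
  intro u
  have : Finite (Colex (Finset α)) := Finite.of_equiv _ toColex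
  induction u using WellFoundedLT.induction with
  | ind u ih =>
    have ih' : ∀ j, toColex j < u → walshTransform z j = 0 := fun j hj => ih _ hj
    obtain ⟨i, rfl⟩ := toColex.surjective u
    rw [ofColex_toColex]
    by_cases h : ∃ p, IsPred i p
    · obtain ⟨p, hp⟩ := h
      have h1 := walshTransform_recursion (hA i p hp) z
      rw [hz, ih' p hp.2.2.1, sum_eq_zero] at h1
      · simpa using h1.symm
      · intro a ha
        rw [mem_ssubsets] at ha
        rw [ih' _ (IsPred.union_left_lt ha),
          ih' _ ((IsPred.union_right_lt ha).trans hp.2.2.1), add_zero]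
    · have := hz i
      rwa [hA' i h] at this

/-- The exponential growth of the solution of the linear recursion. -/
lemma recursion_growth [LinearOrder α] [Fintype α] {y : Finset α → ℝ}
    (hlow : ∀ i, ¬ 5 ≤ #i → y i = -1)
    (hmin : ∀ i, 5 ≤ #i → (¬ ∃ p, IsPred i p) → y i = 1)
    (hrec : ∀ i p, IsPred i p → 2 ^ #(i ∩ p) * (1 + y p) = y i + y p +
      ∑ a ∈ (i ∩ p).ssubsets, (y (a ∪ (i \ p)) + y (a ∪ (p \ i))))
    (i : Finset α) (hi : 5 ≤ #i) :
    1 ≤ y i ∧ (∀ j, 5 ≤ #j → toColex j < toColex i → 4 * y j ≤ y i) ∧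
      2 ^ (∑ j with 5 ≤ #j ∧ toColex j ≤ toColex i, (#j - 3)) ≤ y i * 2 ^ Fintype.card α := by
  suffices h : ∀ u : Colex (Finset α), 5 ≤ #(ofColex u) → 1 ≤ y (ofColex u) ∧
      (∀ j, 5 ≤ #j → toColex j < u → 4 * y j ≤ y (ofColex u)) ∧
      2 ^ (∑ j with 5 ≤ #j ∧ toColex j ≤ u, (#j - 3)) ≤ y (ofColex u) * 2 ^ Fintype.card α from
    h (toColex i) hi
  intro u
  have : Finite (Colex (Finset α)) := Finite.of_equiv _ toColex
  induction u using WellFoundedLT.induction with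
  | ind u ih =>
    replace ih : ∀ p, toColex p < u → 5 ≤ #p → _ := fun p hp h => ih _ hp h
    obtain ⟨i, rfl⟩ := toColex.surjective u
    simp only [ofColex_toColex] at *
    intro hi
    by_cases h : ∃ p, IsPred i p
    · obtain ⟨p, hp⟩ := h
      obtain ⟨hp1, hp4, hpb⟩ := ih p hp.2.2.1 hp.2.1
      -- Upper bounds suffice, as these terms enter the recursion with a minus sign. The value `-1`
      -- on small sets is what makes them harmless.
      have hsmall : ∀ j, toColex j < toColex i → j ≠ p → y j ≤ y p / 4 := by
        intro j hj hjp
        by_cases h5 : 5 ≤ #j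
        · have := hp4 j h5 (lt_of_le_of_ne (hp.2.2.2 j h5 hj) (by simpa using hjp))
          linarith
        · rw [hlow j h5]; linarith
      have hsum : ∑ a ∈ (i ∩ p).ssubsets, (y (a ∪ (i \ p)) + y (a ∪ (p \ i)))
          ≤ (2 ^ #(i ∩ p) - 1) * (y p / 2) := by
        have h1 : ∀ a ∈ (i ∩ p).ssubsets, y (a ∪ (i \ p)) + y (a ∪ (p \ i)) ≤ y p / 2 := by
          intro a ha
          rw [mem_ssubsets] at ha
          have h2 := hsmall _ (IsPred.union_left_lt ha) hp.union_left_ne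
          have h3 := IsPred.union_right_lt ha
          have h4 := hsmall _ (h3.trans hp.2.2.1) (by rintro he; rw [he] at h3; exact h3.false)
          linarith
        refine (sum_le_card_nsmul _ _ _ h1).trans_eq ?_
        rw [nsmul_eq_mul, ssubsets, card_erase_of_mem (mem_powerset_self _), card_powerset,
          Nat.cast_sub Nat.one_le_two_pow]
        push_cast
        ring
      have hc := hp.card_inter
      obtain ⟨c, hc'⟩ : ∃ c, #i = c + 5 := ⟨#i - 5, by omega⟩
      have hcard : #(i ∩ p) = c + 4 := by omega
      have hr := hrec i p hp
      rw [hcard] at hr hsum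
      have hpow : (1 : ℝ) ≤ 2 ^ c := one_le_pow₀ (by norm_num)
      -- With `k = c + 4`, `y i` is `2 ^ k + (2 ^ k - 1) * y p` minus a sum of at most half the
      -- second term. The threshold five makes the factor `2 ^ (c + 2)` at least `4`, as the
      -- induction requires.
      have hmain : 2 ^ (c + 2) * y p ≤ y i := by
        rw [pow_add] at hr hsum ⊢
        nlinarith [mul_nonneg (sub_nonneg.2 hpow) (sub_nonneg.2 hp1)]
      have h4 : 4 * y p ≤ y i := by
        rw [pow_add] at hmain
        nlinarith [mul_nonneg (sub_nonneg.2 hpow) (sub_nonneg.2 hp1)]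
      refine ⟨by linarith, fun j h5 hj => ?_, ?_⟩
      · by_cases hjp : j = p
        · rw [hjp]; exact h4
        · have := hsmall j hj hjp
          linarith
      · have hset : (univ.filter fun j : Finset α => 5 ≤ #j ∧ toColex j ≤ toColex i) =
            insert i (univ.filter fun j : Finset α => 5 ≤ #j ∧ toColex j ≤ toColex p) := by
          ext j
          simp only [mem_filter, mem_univ, true_and, mem_insert]
          constructor
          · rintro ⟨h5, hj⟩
            rcases hj.lt_or_eq with hj | hj
            · exact Or.inr ⟨h5, hp.2.2.2 j h5 hj⟩
            · exact Or.inl (toColex.injective hj)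
          · rintro (rfl | ⟨h5, hj⟩)
            · exact ⟨hi, le_rfl⟩
            · exact ⟨h5, hj.trans hp.2.2.1.le⟩
        rw [hset, sum_insert (by simp [hp.2.2.1]), pow_add, hc', show c + 5 - 3 = c + 2 by omega]
        calc _ ≤ 2 ^ (c + 2) * (y p * 2 ^ Fintype.card α) := by gcongr
          _ = (2 ^ (c + 2) * y p) * 2 ^ Fintype.card α := by ring
          _ ≤ _ := by gcongr
    -- Here `i` is the least large set; the factor `2 ^ Fintype.card α` pays for its term in the
    -- exponent.
    · have hno : ∀ j, 5 ≤ #j → ¬ toColex j < toColex i := fun j h5 hj =>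
        h (exists_isPred h5 hi hj)
      rw [hmin i hi h]
      refine ⟨le_rfl, fun j h5 hj => absurd hj (hno j h5), ?_⟩
      have hset : (univ.filter fun j : Finset α => 5 ≤ #j ∧ toColex j ≤ toColex i) = {i} := by
        ext j
        simp only [mem_filter, mem_univ, true_and, mem_singleton]
        constructor
        · rintro ⟨h5, hj⟩
          exact toColex.injective (hj.eq_of_not_lt (hno j h5))
        · rintro rfl
          exact ⟨hi, le_rfl⟩
      rw [hset, sum_singleton, one_mul]
      exact pow_le_pow_right₀ (by norm_num) ((Nat.sub_le _ _).trans (card_le_univ i))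

lemma mul_two_pow_le_sum_card_sub (m : ℕ) : m * 2 ^ m ≤
    2 * (∑ j : Finset (Fin m) with 5 ≤ #j ∧ toColex j ≤ toColex univ, (#j - 3)) + 8 * 2 ^ m := by
  have h1 : 2 * ∑ j : Finset (Fin m), #j = m * 2 ^ m := by
    have h : ∑ j : Finset (Fin m), #jᶜ = ∑ j : Finset (Fin m), #j :=
      Equiv.sum_comp (Equiv.ofBijective _ compl_bijective) fun j : Finset (Fin m) => #j
    rw [two_mul]
    nth_rw 2 [← h]
    rw [← sum_add_distrib]
    simp [card_add_card_compl, mul_comm]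
  have h2 : ∀ j : Finset (Fin m), #j ≤ (if 5 ≤ #j then #j - 3 else 0) + 4 := by
    intro j; split_ifs <;> omega
  have h3 := sum_le_sum fun j (_ : j ∈ univ) => h2 j
  rw [sum_add_distrib, ← sum_filter] at h3
  simp only [sum_const, card_univ, Fintype.card_finset, Fintype.card_fin, smul_eq_mul] at h3
  simp only [toColex_le_toColex_of_subset (subset_univ _), and_true]
  omega

end Rows


/-! ### From sign matrices to minimal sequences. -/

section BoxSequences

open Finset

lemma card_le_tau {ι J : Type*} [Fintype ι] [Fintype J] (v : J → ι → ℝ)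
    (hv : ∀ j i, |v j i| ≤ 1) (hsum : ∀ i, |∑ j, v j i| ≤ 1)
    (hS : ∀ S : Finset J, 2 ≤ #S → #S < Fintype.card J → ∃ i, 1 < |∑ j ∈ S, v j i|) :
    (Fintype.card J : ℕ∞) ≤ tau (Fintype.card ι) := by
  classical
  have hbox : ∀ {x : Fin (Fintype.card ι) → ℝ}, x ∈ box (Fintype.card ι) ↔ ∀ k, |x k| ≤ 1 := by
    intro x
    simp [_root_.box, Pi.le_def, abs_le, forall_and]
  let e := (Fintype.equivFin J).symm
  let f := (Fintype.equivFin ι).symm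
  refine le_sSup ⟨Fintype.card J, fun a k => v (e a) (f k), ⟨?_, ?_, ?_⟩, rfl⟩
  · exact fun a => hbox.2 fun k => hv _ _
  · rw [hbox]
    intro k
    rw [Finset.sum_apply, Equiv.sum_comp e fun j => v j (f k)]
    exact hsum _
  · intro S h2 hlt hmem
    rw [hbox] at hmem
    obtain ⟨i, hi⟩ := hS (S.map e.toEmbedding) (by simpa using h2) (by simpa using hlt)
    refine absurd (hmem (f.symm i)) (not_le.2 ?_)
    rw [Finset.sum_apply]
    simpa using hi

lemma sum_comp_fst_eq {κ M : Type*} [Fintype κ] [DecidableEq κ] [AddCommMonoid M] {N : κ → ℕ}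
    (S : Finset (Σ k, Fin (N k))) (f : κ → M) :
    ∑ s ∈ S, f s.1 = ∑ k, #(S.filter fun s => s.1 = k) • f k := by
  rw [← sum_fiberwise S (fun s => s.1)]
  refine sum_congr rfl fun k _ => ?_
  rw [← sum_const]
  exact sum_congr rfl fun s hs => by rw [(mem_filter.1 hs).2]

/-- A positive integral relation between the columns of a sign matrix gives a minimal sequence,
provided no proper part of it sums to `0` or to the all `-1` vector. -/
lemma sum_le_tau_of_relation {ι κ : Type*} [Fintype ι] [Fintype κ] (B : ι → κ → ℤ)
    (hB : ∀ i k, B i k = 1 ∨ B i k = -1) (N : κ → ℕ) (hN : ∀ i, ∑ k, B i k * N k = 0)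
    (hmin : ∀ n : κ → ℕ, n ≤ N → 2 ≤ ∑ k, n k → ∑ k, n k < ∑ k, N k →
      (¬ ∀ i, ∑ k, B i k * n k = 0) ∧ ¬ ∀ i, ∑ k, B i k * n k = -1) :
    ((∑ k, N k : ℕ) : ℕ∞) ≤ tau (Fintype.card ι) := by
  classical
  have hcard : Fintype.card (Σ k, Fin (N k)) = ∑ k, N k := by simp
  rw [← hcard]
  set t := ∑ k, N k
  rcases Nat.eq_zero_or_pos t with h0 | htpos
  · rw [hcard, h0]; exact bot_le
  have htR : (1 : ℝ) ≤ t := by exact_mod_cast htpos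
  -- Entries `1` are kept and entries `-1` become `-1 + 1/t`; the full sum becomes `1/2` in every
  -- coordinate.
  let u : ι → κ → ℝ := fun i k => B i k + (1 / t) * ((1 - B i k) / 2)
  have hu : ∀ (S : Finset (Σ k, Fin (N k))) i, ∑ s ∈ S, u i s.1 =
      ((∑ s ∈ S, B i s.1 : ℤ) : ℝ) + (1 / t) * ((#S - ((∑ s ∈ S, B i s.1 : ℤ) : ℝ)) / 2) := by
    intro S i
    simp only [u, sum_add_distrib, ← mul_sum, ← sum_div, sum_sub_distrib, sum_const,
      nsmul_eq_mul, mul_one, Int.cast_sum]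
  have hn : ∀ (S : Finset (Σ k, Fin (N k))) i, ∑ s ∈ S, B i s.1 =
      ∑ k, B i k * (#(S.filter fun s => s.1 = k) : ℤ) := by
    intro S i
    rw [sum_comp_fst_eq S (B i)]
    exact sum_congr rfl fun k _ => by rw [nsmul_eq_mul, mul_comm]
  have hfib : ∀ (S : Finset (Σ k, Fin (N k))), #S = ∑ k, #(S.filter fun s => s.1 = k) := by
    intro S
    simpa using sum_comp_fst_eq S (fun _ => (1 : ℕ))
  refine card_le_tau (fun s i => u i s.1) (fun s i => ?_) (fun i => ?_) (fun S h2 hlt => ?_)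
  · have h1 : 0 ≤ 1 / (t : ℝ) := by positivity
    have h2 : 1 / (t : ℝ) ≤ 1 := by rw [div_le_one (by linarith)]; exact htR
    rcases hB i s.1 with h | h <;> simp only [u, h] <;> rw [abs_le] <;> push_cast <;>
      constructor <;> linarith
  · rw [hu]
    have h1 : ∑ s : (Σ k, Fin (N k)), B i s.1 = 0 := by
      rw [Fintype.sum_sigma, ← hN i]
      exact sum_congr rfl fun k _ => by simp [mul_comm]
    rw [h1, card_univ, hcard]
    have : (1 / (t : ℝ)) * ((t - ((0 : ℤ) : ℝ)) / 2) = 1 / 2 := by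
      field_simp; simp
    rw [this]
    norm_num [abs_le]
  · by_contra! hcon
    rw [hcard] at hlt
    have hpar : ∀ i, (∑ s ∈ S, B i s.1) % 2 = (#S : ℤ) % 2 := by
      intro i
      have : (#S : ℤ) = ∑ s ∈ S, 1 := by simp
      rw [this]
      refine Int.ModEq.sum (n := 2) fun s _ => ?_
      rcases hB i s.1 with h | h <;> simp [h, Int.ModEq]
    have hle : ∀ i, -(#S : ℤ) ≤ ∑ s ∈ S, B i s.1 ∧ ∑ s ∈ S, B i s.1 ≤ #S := by
      intro i
      rw [← abs_le]
      refine (abs_sum_le_sum_abs _ _).trans_eq ?_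
      rw [sum_congr rfl (g := fun _ => (1 : ℤ))]
      · simp
      · intro s _
        rcases hB i s.1 with h | h <;> rw [h] <;> rfl
    -- The coordinate is `b + M / t`, where `M < t` counts the entries `-1`. Being in `[-1, 1]`
    -- leaves `b = -1`, `b = 0`, or `b = 1` with `M = 0`; the last would force `#S = 1`.
    have hval : ∀ i, ∑ s ∈ S, B i s.1 = 0 ∨ ∑ s ∈ S, B i s.1 = -1 := by
      intro i
      have h := hcon i
      rw [hu] at h
      obtain ⟨hl1, hl2⟩ := hle i
      have hp := hpar i
      generalize hb : ∑ s ∈ S, B i s.1 = b at *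
      obtain ⟨M, hM⟩ : ∃ M : ℤ, (#S : ℤ) = b + 2 * M := ⟨(#S - b) / 2, by omega⟩
      have hMR : ((#S : ℝ) - b) / 2 = M := by
        have : (#S : ℝ) = b + 2 * M := by exact_mod_cast hM
        linarith
      have hM0 : 0 ≤ M := by omega
      have hMt : M < t := by omega
      rw [hMR, abs_le] at h
      have hfrac : 1 / (t : ℝ) * M < 1 := by
        rw [one_div, inv_mul_lt_one₀ (by linarith)]
        exact_mod_cast hMt
      have hfrac0 : 0 ≤ 1 / (t : ℝ) * M := by
        have : (0 : ℝ) ≤ M := by exact_mod_cast hM0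
        positivity
      have hb1 : (-2 : ℝ) < b := by linarith [h.1]
      have hb2 : (b : ℝ) ≤ 1 := by linarith [h.2]
      have hb1' : -2 < b := by exact_mod_cast hb1
      have hb2' : b ≤ 1 := by exact_mod_cast hb2
      have hb3 : b ≠ 1 := by
        rintro rfl
        have hMpos : (0 : ℝ) < M := by exact_mod_cast (by omega : 0 < M)
        have : 0 < 1 / (t : ℝ) * M := by positivity
        push_cast at h
        linarith [h.2]
      omega
    have hnle : (fun k => #(S.filter fun s => s.1 = k)) ≤ N := by
      intro k
      have : S.filter (fun s => s.1 = k) ⊆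
          (univ : Finset (Fin (N k))).map (Function.Embedding.sigmaMk k) := by
        rintro ⟨k', x⟩ hs
        obtain ⟨-, rfl⟩ := mem_filter.1 hs
        simp
      simpa using card_le_card this
    have hm := hmin _ hnle (by rwa [← hfib]) (by rwa [← hfib])
    simp only [← hn] at hm
    -- All coordinates of the sign sum have the parity of `#S`, so they are all `0` or all `-1`.
    rcases Nat.mod_two_eq_zero_or_one #S with h | h
    · exact hm.1 fun i => by have := hpar i; have := hval i; omega
    · exact hm.2 fun i => by have := hpar i; have := hval i; omega

/-- If `A` is an invertible sign matrix and `A z` is a sign vector, then `‖z‖₁ ≤ τ`. -/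
lemma sum_abs_le_tau {ι : Type*} [Fintype ι] [DecidableEq ι] (A : Matrix ι ι ℤ)
    (hA : ∀ i j, A i j = 1 ∨ A i j = -1)
    (hinj : ∀ z : ι → ℝ, (∀ i, ∑ j, (A i j : ℝ) * z j = 0) → z = 0)
    (w : ι → ℤ) (hw : ∀ i, w i = 1 ∨ w i = -1) (z : ι → ℝ)
    (hz : ∀ i, ∑ j, (A i j : ℝ) * z j = w i) :
    ∃ t : ℕ, (t : ℕ∞) ≤ tau (Fintype.card ι) ∧ ∑ j, |z j| ≤ t := by
  classical
  have hdet : A.det ≠ 0 := by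
    intro h
    obtain ⟨v, hv, hAv⟩ := Matrix.exists_mulVec_eq_zero_iff.2 h
    have := hinj (fun j => v j) fun i => by
      have := congrArg (Int.cast : ℤ → ℝ) (congrFun hAv i)
      simpa [Matrix.mulVec, dotProduct] using this
    exact hv (funext fun j => by have := congrFun this j; simpa using this)
  let σ : ι → ℤ := fun j => if 0 ≤ z j then 1 else -1
  have hσ : ∀ j, σ j = 1 ∨ σ j = -1 := fun j => by simp only [σ]; split_ifs <;> simp
  have hσz : ∀ j, (σ j : ℝ) * |z j| = z j := by
    intro j
    simp only [σ]
    split_ifs with h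
    · simp [abs_of_nonneg h]
    · simp [abs_of_neg (not_le.1 h)]
  have hσσ : ∀ j, (σ j : ℝ) * σ j = 1 := fun j => by rcases hσ j with h | h <;> simp [h]
  have hww : ∀ i, (w i : ℝ) * w i = 1 := fun i => by rcases hw i with h | h <;> simp [h]
  -- uniqueness of the solution for the matrix with flipped rows and columns
  have huniq : ∀ (n : ι → ℝ) (c : ℝ), (∀ i, ∑ j, (w i * A i j * σ j : ℝ) * n j = c) →
      ∀ j, n j = c * |z j| := by
    intro n c h j
    have h0 := hinj (fun j => σ j * n j - c * z j) fun i => by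
      have h1 : ∑ j, (A i j : ℝ) * (σ j * n j) = w i * c := by
        rw [← h i, mul_sum]
        refine sum_congr rfl fun j _ => ?_
        linear_combination (-(A i j : ℝ) * σ j * n j) * hww i
      simp_rw [mul_sub, sum_sub_distrib]
      rw [h1]
      have h2 : ∑ j, (A i j : ℝ) * (c * z j) = c * w i := by
        rw [← hz i, mul_sum]
        exact sum_congr rfl fun j _ => by ring
      rw [h2]; ring
    have h3 := congrFun h0 j
    simp only [Pi.zero_apply] at h3
    rw [← hσz j] at h3
    linear_combination σ j * h3 - (n j - c * |z j|) * hσσ j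
  -- a common denominator
  have hex : ∃ q : ℕ, 0 < q ∧ ∀ j, ∃ n : ℕ, (n : ℝ) = q * |z j| := by
    -- By Cramer's rule, the determinant is a common denominator.
    refine ⟨A.det.natAbs, Int.natAbs_pos.2 hdet, fun j => ?_⟩
    have h1 : (A.det : ℝ) * z j = ((A.adjugate.mulVec w) j : ℤ) := by
      have h2 := Matrix.adjugate_mul A
      have h3 : ∀ l, ∑ i, (A.adjugate j i : ℝ) * A i l = if j = l then (A.det : ℝ) else 0 := by
        intro l
        have := congrArg (Int.cast : ℤ → ℝ) (congrFun (congrFun h2 j) l)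
        simpa [Matrix.mul_apply, Matrix.one_apply] using this
      simp only [Matrix.mulVec, dotProduct, Int.cast_sum, Int.cast_mul]
      simp_rw [← hz, mul_sum]
      rw [sum_comm]
      simp_rw [← mul_assoc, ← sum_mul, h3]
      simp
    refine ⟨((A.adjugate.mulVec w) j).natAbs, ?_⟩
    rw [Nat.cast_natAbs, Nat.cast_natAbs, Int.cast_abs, Int.cast_abs, ← h1, abs_mul]
  obtain ⟨hq, hqz⟩ := Nat.find_spec hex
  have hqmin := fun m hm => Nat.find_min hex (m := m) hm
  generalize Nat.find hex = q at hq hqz hqmin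
  have hqR : (1 : ℝ) ≤ q := by exact_mod_cast hq
  choose N hN using hqz
  let B : ι → Option ι → ℤ := fun i k => k.elim (-1) fun j => w i * A i j * σ j
  let N' : Option ι → ℕ := fun k => k.elim q N
  refine ⟨∑ k, N' k, sum_le_tau_of_relation B ?_ N' ?_ ?_, ?_⟩
  · rintro i (_ | j)
    · exact Or.inr rfl
    · rcases hw i with h1 | h1 <;> rcases hA i j with h2 | h2 <;> rcases hσ j with h3 | h3 <;>
        simp [B, h1, h2, h3]
  · intro i
    rw [Fintype.sum_option]
    have : ∑ j, (w i * A i j * σ j : ℝ) * N j = q := by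
      calc ∑ j, (w i * A i j * σ j : ℝ) * N j = q * (w i * ∑ j, (A i j : ℝ) * z j) := by
            rw [mul_sum, mul_sum]
            refine sum_congr rfl fun j _ => ?_
            rw [hN, ← congrArg (A i j * · : ℝ → ℝ) (hσz j)]; ring
        _ = q := by rw [hz, hww, mul_one]
    have h2 : ∑ j, w i * A i j * σ j * (N j : ℤ) = q := by exact_mod_cast this
    simp only [B, N', Option.elim]
    rw [h2]; ring
  · intro n hn h2 hlt
    have hred : ∀ c : ℤ, (∀ i, ∑ k, B i k * (n k : ℤ) = c) →
        ∀ j, (n (some j) : ℝ) = (n none + c) * |z j| := by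
      intro c h
      refine huniq (fun j => n (some j)) _ fun i => ?_
      have h1 := h i
      rw [Fintype.sum_option] at h1
      simp only [B, Option.elim] at h1
      have h3 : ∑ j, w i * A i j * σ j * (n (some j) : ℤ) = n none + c := by linarith
      exact_mod_cast h3
    have hn0 : n none ≤ q := hn none
    rw [Fintype.sum_option, Fintype.sum_option] at hlt
    rw [Fintype.sum_option] at h2
    simp only [N', Option.elim] at hlt
    constructor
    · intro h
      have h1 := hred 0 h
      simp only [Int.cast_zero, add_zero] at h1
      rcases Nat.eq_zero_or_pos (n none) with h0 | h0
      · have : ∀ j, n (some j) = 0 := fun j => by simpa [h0] using h1 j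
        simp [h0, this] at h2
      · have hqq : n none = q := by
          by_contra hne
          exact hqmin _ (lt_of_le_of_ne hn0 hne) ⟨h0, fun j => ⟨_, h1 j⟩⟩
        have : ∀ j, n (some j) = N j := fun j => by
          have h3 := h1 j
          rw [hqq, ← hN] at h3
          exact_mod_cast h3
        simp [hqq, this] at hlt
    -- A subsum equal to `-1` would make `n none - 1` a smaller common denominator, unless `n none ≤
    -- 1`, when no other column can occur.
    · intro h
      have h1 := hred (-1) h
      push_cast at h1
      rcases Nat.lt_or_ge (n none) 2 with h0 | h0
      · have : ∀ j, n (some j) = 0 := fun j => by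
          have h3 : (n none : ℝ) ≤ 1 := by exact_mod_cast (by omega : n none ≤ 1)
          have h4 : (n (some j) : ℝ) ≤ 0 := by
            rw [h1 j]
            exact mul_nonpos_of_nonpos_of_nonneg (by linarith) (abs_nonneg _)
          exact_mod_cast le_antisymm h4 (Nat.cast_nonneg _)
        simp only [this, sum_const_zero] at h2
        omega
      · refine hqmin (n none - 1) (by omega) ⟨by omega, fun j => ⟨n (some j), ?_⟩⟩
        rw [h1 j, Nat.cast_sub (by omega)]
        push_cast; ring
  · rw [Fintype.sum_option]
    simp only [N', Option.elim]
    push_cast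
    have : ∑ j, |z j| ≤ ∑ j, (N j : ℝ) := by
      refine sum_le_sum fun j _ => ?_
      rw [hN]
      exact le_mul_of_one_le_left (abs_nonneg _) hqR
    linarith

lemma one_le_tau (d : ℕ) : 1 ≤ tau d := by
  refine le_sSup ⟨1, fun _ _ => 0, ⟨fun _ => ?_, ?_, fun S h2 hlt => by omega⟩, by simp⟩
  · simp [_root_.box, Pi.le_def]
  · simp [_root_.box, Pi.le_def]

end BoxSequences

/-! ### The lower bound for powers of two. -/

section LowerBound

open Finset Colex

lemma exists_two_pow_le_tau {m : ℕ} (hm : 5 ≤ m) : ∃ t G : ℕ, (t : ℕ∞) ≤ tau (2 ^ m) ∧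
    m * 2 ^ m ≤ 2 * G + 8 * 2 ^ m ∧ 2 ^ G ≤ t * 2 ^ m := by
  obtain ⟨A, hA, hA1, hA2⟩ := exists_sign_matrix (Fin m)
  have hinj : ∀ z : Finset (Fin m) → ℝ, (∀ i, ∑ x, (A i x : ℝ) * z x = 0) → z = 0 :=
    fun z hz => sign_matrix_injective hA1 hA2 hz
  let w : Finset (Fin m) → ℤ := fun i => if 5 ≤ #i then 1 else -1
  obtain ⟨z, hz⟩ : ∃ z : Finset (Fin m) → ℝ, ∀ i, ∑ x, (A i x : ℝ) * z x = w i := by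
    let f := (A.map (Int.cast : ℤ → ℝ)).mulVecLin
    have hf : Function.Injective f := by
      rw [← LinearMap.ker_eq_bot, LinearMap.ker_eq_bot']
      exact fun z hz => hinj z fun i => congrFun hz i
    obtain ⟨z, hz⟩ := LinearMap.injective_iff_surjective.1 hf fun i => (w i : ℝ)
    exact ⟨z, fun i => congrFun hz i⟩
  obtain ⟨t, ht, htz⟩ := sum_abs_le_tau A hA hinj w
    (fun i => by simp only [w]; split_ifs <;> simp) z hz
  simp only [Fintype.card_finset, Fintype.card_fin] at ht
  refine ⟨t, _, ht, mul_two_pow_le_sum_card_sub m, ?_⟩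
  have hgrowth := (recursion_growth (y := walshTransform z) ?_ ?_ ?_ (univ : Finset (Fin m))
    (by simpa using hm)).2.2
  · have h1 : walshTransform z univ ≤ t :=
      (le_abs_self _).trans ((abs_walshTransform_le z univ).trans htz)
    rw [Fintype.card_fin] at hgrowth
    have h2 := hgrowth.trans (mul_le_mul_of_nonneg_right h1 (by positivity))
    exact_mod_cast h2
  · intro i hi
    have hno : ¬ ∃ p, IsPred i p := fun ⟨p, hp⟩ => hi hp.1
    have := hz i
    rw [hA2 i hno] at this
    simpa [walshTransform, w, hi] using this
  · intro i hi hno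
    have := hz i
    rw [hA2 i hno] at this
    simpa [walshTransform, w, hi] using this
  · intro i p hp
    have := walshTransform_recursion (hA1 i p hp) z
    rw [hz i] at this
    simpa [w, hp.1] using this

end LowerBound

theorem theorem2 :
    ∃ c : ℝ, 0 < c ∧ ∀ d : ℕ, (∃ k : ℕ, d = 2 ^ k) →
      ENNReal.ofReal ((c * (d : ℝ)) ^ ((d : ℝ) / 2)) ≤ ((tau d : ℕ∞) : ENNReal) := by
  -- Of the ten factors of two, eight cover the loss `8 * 2 ^ m` in the exponent and two absorb the
  -- factor `2 ^ m` beside `t`. For `m < 10` the base is at most `1`.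
  refine ⟨1 / 2 ^ 10, by positivity, ?_⟩
  rintro d ⟨m, rfl⟩
  rcases Nat.lt_or_ge m 10 with hm | hm
  · have h1 : (1 / 2 ^ 10 * ((2 ^ m : ℕ) : ℝ)) ^ (((2 ^ m : ℕ) : ℝ) / 2) ≤ 1 := by
      refine Real.rpow_le_one (by positivity) ?_ (by positivity)
      rw [one_div, inv_mul_le_one₀ (by positivity)]
      push_cast
      exact pow_le_pow_right₀ (by norm_num) hm.le
    calc _ ≤ ENNReal.ofReal 1 := ENNReal.ofReal_le_ofReal h1
      _ = ((1 : ℕ∞) : ENNReal) := by simp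
      _ ≤ _ := ENat.toENNReal_le.2 (one_le_tau _)
  · obtain ⟨t, G, ht, hG, htG⟩ := exists_two_pow_le_tau (by omega : 5 ≤ m)
    have h1 : (1 / 2 ^ 10 * ((2 ^ m : ℕ) : ℝ)) ^ (((2 ^ m : ℕ) : ℝ) / 2) ≤ t := by
      obtain ⟨n, rfl⟩ : ∃ n, m = n + 10 := ⟨m - 10, by omega⟩
      have hbase : 1 / 2 ^ 10 * ((2 ^ (n + 10) : ℕ) : ℝ) = 2 ^ n := by
        push_cast; rw [pow_add]; field_simp
      have hexp : ((2 ^ (n + 10) : ℕ) : ℝ) / 2 = ((2 ^ (n + 9) : ℕ) : ℝ) := by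
        push_cast; rw [pow_succ]; ring
      rw [hbase, hexp, Real.rpow_natCast, ← pow_mul]
      have hle : n * 2 ^ (n + 9) + (n + 10) ≤ G := by
        have h2 : n + 10 < 2 ^ (n + 10) := Nat.lt_two_pow_self
        have h3 : 2 ^ (n + 10) = 2 * 2 ^ (n + 9) := by rw [pow_succ]; ring
        rw [h3] at hG h2
        nlinarith
      have h4 : 2 ^ (n * 2 ^ (n + 9)) * 2 ^ (n + 10) ≤ t * 2 ^ (n + 10) := by
        rw [← pow_add]
        exact (Nat.pow_le_pow_right (by norm_num) hle).trans htG
      exact_mod_cast Nat.le_of_mul_le_mul_right h4 (by positivity)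
    calc _ ≤ ENNReal.ofReal t := ENNReal.ofReal_le_ofReal h1
      _ = ((t : ℕ∞) : ENNReal) := by simp
      _ ≤ _ := ENat.toENNReal_le.2 ht
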